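/- Let $k\ge 2$ and $N\ge 1$, let $n_1,\dots,n_k$ be positive integers, and let $X$ be a cube complex with exactly $N$ vertices whose edges carry directions (colours) in $\{1,\dots,k\}$ such that opposite edges of a square have the same direction. Suppose that the universal cover of $X$ is a Cartesian product $T_1\times\dots\times T_k$ of trees, where $T_i$ is regular of valency $n_i$, and that the covering map takes the edges in the $i$-th factor to the edges of direction $i$ (equivalently, the deck group preserves each tree factor). Let $\mathrm{DG}(X)$ be the following $k$-coloured directed graph. Its vertices are those of $X$; each geometric edge of $X$ of direction $i$ gives two edges of colour $i$, of opposite orientations. For a path $xy$ of length two (first $x$, then $y$) whose edges have distinct colours, let $\varphi(xy)=y'x'$ be the opposite path with the same endpoints in the unique square of $X$ containing $xy$ as two consecutive sides; here $x'$ has the colour of $x$ and $y'$ has the colour of $y$. Then $\mathrm{DG}(X)$ with $\varphi$ is a $k$-dimensional digraph: it is finite, $\varphi$ is an involution on the paths of length two with two distinct colours which swaps the order of the colours and keeps the endpoints, and for every path $xyz$ with three distinct colours the two ways of reversing the order of its colours by successive applications of $\varphi$ give the same path. Let $\Lambda(X)$ be the category whose objects are the vertices of $X$ and whose morphisms are the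 directed paths in $\mathrm{DG}(X)$ modulo the congruence generated by $xy\sim\varphi(xy)$, and let the degree $d(\lambda)\in\mathbb N^k$ of a morphism count the edges of each colour in a path representing it. Let $e_1,\dots,e_k$ be the generators of $\mathbb N^k$, and for $i=1,\dots,k$ let $M_i$ be the coordinate matrix, $M_i(v,w)=|\{\lambda : d(\lambda)=e_i,\ \lambda \text{ has range } v \text{ and source } w\}|$. Then $\Lambda(X)$ is a $k$-graph: it is a countable small category, $d$ is additive under composition, and whenever $d(\lambda)=m+n$ there is a unique factorisation $\lambda=\mu\nu$ with $d(\mu)=m$ and $d(\nu)=n$. Each $M_i$ is equal to the adjacency matrix of $X$ in direction $i$, whose $(v,w)$ entry is the number of oriented edges of direction $i$ from $v$ to $w$; it is symmetric and each of its row sums equals $n_i$. The vector of spectral radii of the coordinate matrices is $$\rho(\Lambda(X)) := (\rho(M_1),\dots,\rho(M_k)) = (n_1,\dots,n_k).$$ -/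

import Mathlib

open CategoryTheory
open scoped ENNReal symmDiff

universe u

/-! ### Cube complexes with `k` directions -/

/-- A combinatorial cube complex in which every cube carries a set of pairwise distinct directions
(colours) in `Fin k`, parallel edges of a cube having the same direction.

`Cube S` is the set of *cornered* cubes with set of directions `S`: an `#S`-dimensional cell, i.e. a
copy of `[0,1]^S`, together with one of its `2 ^ #S` corners. So `Cube ∅` is the set of vertices,
`Cube {i}` is the set of oriented edges of direction `i` (the corner being the origin), and
`Cube {i, j}` is the set of squares with a choice of one of their four corners.
* `face h c` is the face of `c` with directions `S ⊆ T` that contains the corner of `c`;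
* `flip J c` is the same cell as `c`, whose corner has been moved to the opposite end along all
  directions in `J` (directions in `J \ S` do not matter). For an oriented edge this is the reversal
  of orientation. Distinct corners of one cell are never identified as corners of that cell, which
  is `flip_eq_self_iff`. -/
structure CubeComplex (k : ℕ) where
  Cube : Finset (Fin k) → Type u
  face : ∀ {S T : Finset (Fin k)}, S ⊆ T → Cube T → Cube S
  flip : ∀ {S : Finset (Fin k)}, Finset (Fin k) → Cube S → Cube S
  face_self : ∀ {S : Finset (Fin k)} (h : S ⊆ S) (c : Cube S), face h c = c
  face_face : ∀ {R S T : Finset (Fin k)} (h : R ⊆ S) (h' : S ⊆ T) (h'' : R ⊆ T) (c : Cube T),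
    face h (face h' c) = face h'' c
  flip_flip : ∀ {S : Finset (Fin k)} (J K : Finset (Fin k)) (c : Cube S),
    flip J (flip K c) = flip (J ∆ K) c
  flip_eq_self_iff : ∀ {S : Finset (Fin k)} (J : Finset (Fin k)) (c : Cube S),
    flip J c = c ↔ Disjoint J S
  face_flip : ∀ {S T : Finset (Fin k)} (h : S ⊆ T) (J : Finset (Fin k)) (c : Cube T),
    J ⊆ S → face h (flip J c) = flip J (face h c)

namespace CubeComplex

variable {k : ℕ}

/-- The vertices of a cube complex. -/
abbrev Vertex (X : CubeComplex.{u} k) : Type u := X.Cube ∅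

/-- The oriented edges of direction `i` of a cube complex; each geometric edge of direction `i`
gives rise to exactly two of them. -/
abbrev OrientedEdge (X : CubeComplex.{u} k) (i : Fin k) : Type u := X.Cube {i}

/-- The corner of a cornered cube. -/
def corner (X : CubeComplex.{u} k) {S : Finset (Fin k)} (c : X.Cube S) : X.Vertex :=
  X.face (Finset.empty_subset S) c

/-- The edge of direction `i` of a cornered cube that starts at its corner. -/
def edge (X : CubeComplex.{u} k) {S : Finset (Fin k)} (c : X.Cube S) {i : Fin k} (hi : i ∈ S) :
    X.OrientedEdge i :=
  X.face (Finset.singleton_subset_iff.mpr hi) c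

/-- Reversal of the orientation of an edge. -/
def reverse (X : CubeComplex.{u} k) {i : Fin k} (e : X.OrientedEdge i) : X.OrientedEdge i :=
  X.flip {i} e

/-- The origin of an oriented edge. -/
def origin (X : CubeComplex.{u} k) {i : Fin k} (e : X.OrientedEdge i) : X.Vertex := X.corner e

/-- The terminus of an oriented edge. -/
def terminus (X : CubeComplex.{u} k) {i : Fin k} (e : X.OrientedEdge i) : X.Vertex :=
  X.corner (X.reverse e)

/-- The adjacency matrix in direction `i`: its `(v, w)` entry is the number of edges of direction
`i` leading from `v` to `w` (the geometric edges between `v` and `w` when `v ≠ w`; each loop at `v`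
is counted once for each of its two orientations). -/
noncomputable def adjacencyMatrix (X : CubeComplex.{u} k) (i : Fin k) :
    Matrix X.Vertex X.Vertex ℕ :=
  fun v w => Nat.card {e : X.OrientedEdge i // X.origin e = v ∧ X.terminus e = w}

/-- A cubical map preserving directions. -/
structure Hom (Z X : CubeComplex.{u} k) where
  toFun : ∀ {S : Finset (Fin k)}, Z.Cube S → X.Cube S
  map_face : ∀ {S T : Finset (Fin k)} (h : S ⊆ T) (c : Z.Cube T),
    toFun (Z.face h c) = X.face h (toFun c)
  map_flip : ∀ {S : Finset (Fin k)} (J : Finset (Fin k)) (c : Z.Cube S),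
    toFun (Z.flip J c) = X.flip J (toFun c)

/-- A covering map of cube complexes: it is onto, and it maps the star of every vertex `z`
bijectively onto the star of the image of `z` (every cornered cube at the image of `z` is the image
of exactly one cornered cube at `z`). -/
def Hom.IsCovering {Z X : CubeComplex.{u} k} (p : Hom Z X) : Prop :=
  (∀ v : X.Vertex, ∃ z : Z.Vertex, p.toFun z = v) ∧
    ∀ (S : Finset (Fin k)) (z : Z.Vertex) (c : X.Cube S), X.corner c = p.toFun z →
      ∃! b : Z.Cube S, Z.corner b = z ∧ p.toFun b = c

/-- The Cartesian product of graphs `T i`, `i : Fin k`, as a cube complex: its cells are the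
products of a vertex or an edge of `T i` for every `i`. A cornered cube with directions `S` is given
by its corner and the corner opposite to it: these two have adjacent coordinates in the directions
of `S` and equal ones in the others. -/
def prodGraph {V : Fin k → Type u} (T : ∀ i, SimpleGraph (V i)) : CubeComplex.{u} k where
  Cube S := {p : (∀ i, V i) × (∀ i, V i) //
    ∀ i, (i ∈ S → (T i).Adj (p.1 i) (p.2 i)) ∧ (i ∉ S → p.2 i = p.1 i)}
  face {S _} h c := ⟨(c.1.1, fun i => if i ∈ S then c.1.2 i else c.1.1 i), fun i => by
    refine ⟨fun hi => ?_, fun hi => ?_⟩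
    · simpa [hi] using (c.2 i).1 (h hi)
    · simp [hi]⟩
  flip {_} J c := ⟨(fun i => if i ∈ J then c.1.2 i else c.1.1 i,
      fun i => if i ∈ J then c.1.1 i else c.1.2 i), fun i => by
    refine ⟨fun hi => ?_, fun hi => ?_⟩
    · have := (c.2 i).1 hi
      by_cases hJ : i ∈ J
      · simpa [hJ] using this.symm
      · simpa [hJ] using this
    · have := (c.2 i).2 hi
      by_cases hJ : i ∈ J <;> simp [hJ, this]⟩
  face_self {S} h c := by
    refine Subtype.ext (Prod.ext rfl (funext fun i => ?_))
    by_cases hi : i ∈ S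
    · simp [hi]
    · simp [hi, (c.2 i).2 hi]
  face_face {R S T} h h' h'' c := by
    refine Subtype.ext (Prod.ext rfl (funext fun i => ?_))
    by_cases hi : i ∈ R
    · simp [hi, h hi]
    · simp [hi]
  flip_flip {S} J K c := by
    refine Subtype.ext (Prod.ext (funext fun i => ?_) (funext fun i => ?_)) <;>
      by_cases hJ : i ∈ J <;> by_cases hK : i ∈ K <;> simp [hJ, hK, Finset.mem_symmDiff]
  flip_eq_self_iff {S} J c := by
    constructor
    · intro h
      rw [Finset.disjoint_left]
      intro i hJ hS
      have h1 := congrFun (congrArg (fun b => b.1.1) h) i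
      simp only [hJ, if_true] at h1
      exact ((c.2 i).1 hS).ne h1.symm
    · intro h
      rw [Finset.disjoint_left] at h
      refine Subtype.ext (Prod.ext (funext fun i => ?_) (funext fun i => ?_)) <;>
        by_cases hJ : i ∈ J
      · simp [hJ, (c.2 i).2 (h hJ)]
      · simp [hJ]
      · simp [hJ, (c.2 i).2 (h hJ)]
      · simp [hJ]
  face_flip {S T} h J c hJS := by
    refine Subtype.ext (Prod.ext (funext fun i => ?_) (funext fun i => ?_)) <;>
      by_cases hJ : i ∈ J <;> by_cases hS : i ∈ S <;>
      first
        | exact absurd (hJS hJ) hS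
        | simp [hJ, hS]

/-- `X` is a `k`-cube complex of valencies `n`: it is covered by a Cartesian product of `k` trees,
the `i`-th of which is regular of valency `n i`, by a covering preserving directions. (As a product
of trees is simply connected, it is then the universal cover of `X`.) -/
def IsCoveredByTrees (X : CubeComplex.{u} k) (n : Fin k → ℕ) : Prop :=
  ∃ (V : Fin k → Type u) (T : ∀ i, SimpleGraph (V i)),
    (∀ i, (T i).IsTree ∧ ∀ v, ((T i).neighborSet v).encard = n i) ∧
    ∃ p : Hom (prodGraph T) X, p.IsCovering

end CubeComplex

/-! ### `k`-dimensional digraphs -/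

/-- Ordered pairs `(x, y)` of edges forming a path `xy` of length two (first `x`, then `y`) whose
two edges have distinct colours. -/
def BicolouredPath {k : ℕ} {V E : Type u} (o t : E → V) (colour : E → Fin k) : Type u :=
  {p : E × E // t p.1 = o p.2 ∧ colour p.1 ≠ colour p.2}

/-- A `k`-dimensional digraph: a finite directed graph with edges coloured by `Fin k` and a
bijection `φ` of the set of bicoloured paths of length two satisfying (F1) and (F2). -/
structure KDigraph (k : ℕ) where
  V : Type u
  E : Type u
  finite_V : Finite V
  finite_E : Finite E
  o : E → V
  t : E → V
  colour : E → Fin k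
  φ : BicolouredPath o t colour → BicolouredPath o t colour
  /-- `φ² = 1`, so that `φ` is a bijection. -/
  φ_involutive : Function.Involutive φ
  /-- (F1): if `φ (xy) = y'x'` then `y'` has the colour of `y`, `x'` has the colour of `x`, and the
  paths `xy` and `y'x'` have the same origin and the same terminus. -/
  f1 : ∀ p, colour (φ p).1.1 = colour p.1.2 ∧ colour (φ p).1.2 = colour p.1.1 ∧
    o (φ p).1.1 = o p.1.1 ∧ t (φ p).1.2 = t p.1.2
  /-- (F2), where `xy ∼ y'x'` is written as `∃ h, (φ ⟨(x, y), h⟩).1 = (y', x')`. Primed names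
  `x'`, `x''` are the edges with upper indices `1`, `2`; names `x₁`, `x₂` are those with lower
  indices. -/
  f2 : ∀ x y z x' x'' x₁ x₂ y' y'' y₁ y₂ z' z'' z₁ z₂ : E,
    t x = o y → t y = o z →
    colour x ≠ colour y → colour x ≠ colour z → colour y ≠ colour z →
    (∃ h, (φ ⟨(x, y), h⟩).1 = (y', x')) →
    (∃ h, (φ ⟨(x', z), h⟩).1 = (z', x'')) →
    (∃ h, (φ ⟨(y', z'), h⟩).1 = (z'', y'')) →
    (∃ h, (φ ⟨(y, z), h⟩).1 = (z₁, y₁)) →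
    (∃ h, (φ ⟨(x, z₁), h⟩).1 = (z₂, x₁)) →
    (∃ h, (φ ⟨(x₁, y₁), h⟩).1 = (y₂, x₂)) →
    x₂ = x'' ∧ y₂ = y'' ∧ z₂ = z''

/-! ### Higher rank graphs -/

/-- A small category with a degree in `ℕ^k` assigned to every morphism. -/
structure GradedCategory (k : ℕ) where
  Obj : Type u
  [category : SmallCategory Obj]
  d : ∀ {v w : Obj}, (v ⟶ w) → (Fin k → ℕ)

attribute [instance] GradedCategory.category

namespace GradedCategory

variable {k : ℕ}

/-- `Λ` is a `k`-graph: a countable small category whose degree map is additive and has the unique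
factorisation property. The product `μν` of morphisms (first `ν`, then `μ`) is `ν ≫ μ`; a
factorisation `f = μν` is given as a triple `⟨u, ν, μ⟩`, where `u` is the range of `ν`. -/
structure IsKGraph (Λ : GradedCategory.{u} k) : Prop where
  countable : Countable (Σ (v : Λ.Obj) (w : Λ.Obj), (v ⟶ w))
  d_comp : ∀ {v w x : Λ.Obj} (ν : v ⟶ w) (μ : w ⟶ x), Λ.d (ν ≫ μ) = Λ.d μ + Λ.d ν
  factorisation : ∀ {v w : Λ.Obj} (f : v ⟶ w) (m n : Fin k → ℕ), Λ.d f = m + n →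
    ∃! q : Σ u : Λ.Obj, (v ⟶ u) × (u ⟶ w),
      q.2.1 ≫ q.2.2 = f ∧ Λ.d q.2.2 = m ∧ Λ.d q.2.1 = n

/-- The coordinate matrix `M_i`: its `(v, w)` entry is the number of morphisms of degree `e_i` with
range `v` and source `w`. -/
noncomputable def coordinateMatrix (Λ : GradedCategory.{u} k) (i : Fin k) :
    Matrix Λ.Obj Λ.Obj ℕ :=
  fun v w => Nat.card {f : w ⟶ v // Λ.d f = Pi.single i 1}

open Classical in
/-- The vector `ρ(Λ) = (ρ(M_1), …, ρ(M_k))` of the spectral radii of the coordinate matrices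
(the largest absolute values of their complex eigenvalues). -/
noncomputable def spectralRadiusVector (Λ : GradedCategory.{u} k) [Fintype Λ.Obj] :
    Fin k → ℝ≥0∞ :=
  fun i => spectralRadius ℂ ((Λ.coordinateMatrix i).map (fun a : ℕ => (a : ℂ)))

end GradedCategory

namespace KDigraph

variable {k : ℕ}

/-- The directed graph underlying a `k`-dimensional digraph. -/
instance quiver (D : KDigraph.{u} k) : Quiver.{u} D.V where
  Hom v w := {e : D.E // D.o e = v ∧ D.t e = w}

/-- The path `q` is obtained from the path `p` by diverting: a subpath `xy` of length two with edges
of distinct colours is replaced by `φ(xy) = y'x'`. -/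
inductive Divert (D : KDigraph.{u} k) {v w : D.V} : Quiver.Path v w → Quiver.Path v w → Prop
  | mk {a b u u' : D.V} (p : Quiver.Path v a) (x : a ⟶ u) (y : u ⟶ b) (y' : a ⟶ u') (x' : u' ⟶ b)
      (q : Quiver.Path b w) (h : ∃ h, (D.φ ⟨(x.1, y.1), h⟩).1 = (y'.1, x'.1)) :
      Divert D (((p.cons x).cons y).comp q) (((p.cons y').cons x').comp q)

/-- The number of edges of each colour in a directed path. -/
def pathDegree (D : KDigraph.{u} k) {v : D.V} : ∀ {w : D.V}, Quiver.Path v w → (Fin k → ℕ)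
  | _, .nil => 0
  | _, .cons p e => pathDegree D p + Pi.single (D.colour e.1) 1

theorem pathDegree_comp (D : KDigraph.{u} k) {v w x : D.V} (p : Quiver.Path v w)
    (q : Quiver.Path w x) : D.pathDegree (p.comp q) = D.pathDegree p + D.pathDegree q := by
  induction q with
  | nil => simp [pathDegree]
  | cons q e ih => simp [pathDegree, ih, add_assoc]

theorem Divert.pathDegree_eq {D : KDigraph.{u} k} {v w : D.V} {p q : Quiver.Path v w}
    (h : D.Divert p q) : D.pathDegree p = D.pathDegree q := by
  obtain ⟨p, x, y, y', x', q, h, hφ⟩ := h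
  have h1 := D.f1 ⟨(x.1, y.1), h⟩
  rw [hφ] at h1
  simp only [pathDegree_comp, pathDegree]
  obtain ⟨hy, hx, -⟩ := h1
  change D.colour y'.1 = D.colour y.1 at hy
  change D.colour x'.1 = D.colour x.1 at hx
  rw [hy, hx]
  abel

theorem Divert.comp_left {D : KDigraph.{u} k} {v w x : D.V} (r : Quiver.Path v w)
    {p q : Quiver.Path w x} (h : D.Divert p q) : D.Divert (r.comp p) (r.comp q) := by
  obtain ⟨p, x, y, y', x', q, h⟩ := h
  simpa only [← Quiver.Path.comp_assoc, Quiver.Path.comp_cons] using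
    Divert.mk (r.comp p) x y y' x' q h

theorem Divert.comp_right {D : KDigraph.{u} k} {v w x : D.V} {p q : Quiver.Path v w}
    (h : D.Divert p q) (r : Quiver.Path w x) : D.Divert (p.comp r) (q.comp r) := by
  obtain ⟨p, x, y, y', x', q, h⟩ := h
  simpa only [Quiver.Path.comp_assoc] using Divert.mk p x y y' x' (q.comp r) h

/-- The category `Λ_DG` with its degree map. The objects are the vertices; the morphisms `v ⟶ w` are
the directed paths from `v` to `w` modulo the equivalence relation generated by diverting;
composition is concatenation; the degree of the class of a path counts its edges of each colour. -/
def toGradedCategory (D : KDigraph.{u} k) : GradedCategory.{u} k where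
  Obj := D.V
  category :=
    { Hom := fun v w => Quot (D.Divert (v := v) (w := w))
      id := fun v => Quot.mk _ (Quiver.Path.nil : Quiver.Path v v)
      comp := fun f g => Quot.map₂ Quiver.Path.comp (fun r _ _ h => h.comp_left r)
        (fun _ _ r h => h.comp_right r) f g
      id_comp := by
        rintro v w ⟨p⟩
        exact congrArg (Quot.mk _) (Quiver.Path.nil_comp p)
      comp_id := by
        rintro v w ⟨p⟩
        rfl
      assoc := by
        rintro v w x y ⟨p⟩ ⟨q⟩ ⟨r⟩
        exact congrArg (Quot.mk _) (Quiver.Path.comp_assoc p q r) }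
  d := fun {v w} f => Quot.lift (fun p : Quiver.Path (V := D.V) v w => D.pathDegree p)
    (fun _ _ h => h.pathDegree_eq) f

noncomputable instance (D : KDigraph.{u} k) : Fintype D.toGradedCategory.Obj :=
  haveI : Finite D.toGradedCategory.Obj := D.finite_V
  Fintype.ofFinite D.toGradedCategory.Obj

end KDigraph

/-! ### The `k`-dimensional digraph and the `k`-graph of a `k`-cube complex -/

namespace CubeComplex

variable {k : ℕ}

theorem edge_face (X : CubeComplex.{u} k) {S T : Finset (Fin k)} (h : S ⊆ T) (c : X.Cube T)
    {i : Fin k} (hi : i ∈ S) : X.edge (X.face h c) hi = X.edge c (h hi) :=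
  X.face_face _ _ _ c

theorem corner_face (X : CubeComplex.{u} k) {S T : Finset (Fin k)} (h : S ⊆ T) (c : X.Cube T) :
    X.corner (X.face h c) = X.corner c :=
  X.face_face _ _ _ c

theorem origin_edge (X : CubeComplex.{u} k) {S : Finset (Fin k)} (c : X.Cube S) {i : Fin k}
    (hi : i ∈ S) : X.origin (X.edge c hi) = X.corner c :=
  X.corner_face _ c

theorem edge_flip_self (X : CubeComplex.{u} k) {S : Finset (Fin k)} (c : X.Cube S) {i : Fin k}
    (hi : i ∈ S) : X.edge (X.flip {i} c) hi = X.reverse (X.edge c hi) :=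
  X.face_flip _ _ c (Finset.Subset.refl _)

theorem terminus_edge (X : CubeComplex.{u} k) {S : Finset (Fin k)} (c : X.Cube S) {i : Fin k}
    (hi : i ∈ S) : X.terminus (X.edge c hi) = X.corner (X.flip {i} c) := by
  rw [terminus, ← edge_flip_self]
  exact X.corner_face _ _

theorem flip_flip_self (X : CubeComplex.{u} k) {S : Finset (Fin k)} (J : Finset (Fin k))
    (c : X.Cube S) : X.flip J (X.flip J c) = c := by
  rw [X.flip_flip, X.flip_eq_self_iff]
  simp

theorem flip_comm (X : CubeComplex.{u} k) {S : Finset (Fin k)} (J K : Finset (Fin k))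
    (c : X.Cube S) : X.flip J (X.flip K c) = X.flip K (X.flip J c) := by
  rw [X.flip_flip, X.flip_flip, symmDiff_comm]

theorem Hom.map_corner {Z X : CubeComplex.{u} k} (p : Hom Z X) {S : Finset (Fin k)}
    (c : Z.Cube S) : p.toFun (Z.corner c) = X.corner (p.toFun c) :=
  p.map_face _ c

theorem Hom.map_edge {Z X : CubeComplex.{u} k} (p : Hom Z X) {S : Finset (Fin k)}
    (c : Z.Cube S) {i : Fin k} (hi : i ∈ S) : p.toFun (Z.edge c hi) = X.edge (p.toFun c) hi :=
  p.map_face _ c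

section ProdGraph

variable {V : Fin k → Type u} {T : ∀ i, SimpleGraph (V i)}

theorem prodGraph_corner_fst {S : Finset (Fin k)} (c : (prodGraph T).Cube S) :
    ((prodGraph T).corner c).1.1 = c.1.1 := rfl

theorem prodGraph_edge_snd {S : Finset (Fin k)} (c : (prodGraph T).Cube S) {i : Fin k}
    (hi : i ∈ S) : ((prodGraph T).edge c hi).1.2 i = c.1.2 i := by
  change (if i ∈ ({i} : Finset (Fin k)) then c.1.2 i else c.1.1 i) = c.1.2 i
  simp

theorem prodGraph_ext {S : Finset (Fin k)} (c c' : (prodGraph T).Cube S)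
    (h : (prodGraph T).corner c = (prodGraph T).corner c')
    (h' : ∀ i, i ∈ S → c.1.2 i = c'.1.2 i) : c = c' := by
  have h1 : c.1.1 = c'.1.1 := congrArg (fun b => b.1.1) h
  refine Subtype.ext (Prod.ext h1 (funext fun i => ?_))
  by_cases hi : i ∈ S
  · exact h' i hi
  · rw [(c.2 i).2 hi, (c'.2 i).2 hi, h1]

theorem prodGraph_vertex_ext (z z' : (prodGraph T).Vertex) (h : z.1.1 = z'.1.1) : z = z' := by
  refine Subtype.ext (Prod.ext h (funext fun i => ?_))
  rw [(z.2 i).2 (by simp), (z'.2 i).2 (by simp), h]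

theorem prodGraph_exists {S : Finset (Fin k)} (z : (prodGraph T).Vertex)
    (e : ∀ i, i ∈ S → (prodGraph T).OrientedEdge i)
    (he : ∀ i hi, (prodGraph T).origin (e i hi) = z) :
    ∃ c : (prodGraph T).Cube S, (prodGraph T).corner c = z ∧
      ∀ i hi, (prodGraph T).edge c hi = e i hi := by
  classical
  have he1 : ∀ i hi, (e i hi).1.1 = z.1.1 := fun i hi => congrArg (fun b => b.1.1) (he i hi)
  let c : (prodGraph T).Cube S :=
    ⟨(z.1.1, fun i => if hi : i ∈ S then (e i hi).1.2 i else z.1.1 i), fun i => by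
      refine ⟨fun hi => ?_, fun hi => ?_⟩
      · have h := ((e i hi).2 i).1 (by simp)
        rw [he1] at h
        simpa [hi] using h
      · simp [hi]⟩
  have hc : (prodGraph T).corner c = z := prodGraph_vertex_ext _ _ rfl
  refine ⟨c, hc, fun i hi => prodGraph_ext _ _ ?_ fun j hj => ?_⟩
  · exact ((prodGraph T).origin_edge c hi).trans (hc.trans (he i hi).symm)
  · obtain rfl := Finset.mem_singleton.mp hj
    rw [prodGraph_edge_snd]
    simp [c, hi]

end ProdGraph

/-- In a complex covered by a product of trees, a cornered cube is determined by its edges at the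
corner. -/
theorem IsCoveredByTrees.cube_ext {X : CubeComplex.{u} k} {n : Fin k → ℕ}
    (hX : X.IsCoveredByTrees n) {S : Finset (Fin k)} (c c' : X.Cube S)
    (h : X.corner c = X.corner c') (h' : ∀ i (hi : i ∈ S), X.edge c hi = X.edge c' hi) :
    c = c' := by
  obtain ⟨V, T, -, p, hs, hp⟩ := hX
  obtain ⟨z, hz⟩ := hs (X.corner c)
  obtain ⟨b, ⟨hb, rfl⟩, -⟩ := hp S z c hz.symm
  obtain ⟨b', ⟨hb', rfl⟩, -⟩ := hp S z c' (h.symm.trans hz.symm)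
  congr 1
  refine prodGraph_ext _ _ (hb.trans hb'.symm) fun i hi => ?_
  have h1 := h' i hi
  rw [← p.map_edge, ← p.map_edge] at h1
  obtain ⟨a, -, ha⟩ := hp {i} z (p.toFun ((prodGraph T).edge b hi)) (by
    rw [← p.map_corner]
    exact congrArg p.toFun (((prodGraph T).origin_edge b hi).trans hb))
  have h2 := (ha _ ⟨((prodGraph T).origin_edge b hi).trans hb, rfl⟩).trans
    (ha _ ⟨((prodGraph T).origin_edge b' hi).trans hb', h1.symm⟩).symm
  rw [← prodGraph_edge_snd b hi, h2, prodGraph_edge_snd]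

/-- In a complex covered by a product of trees, edges of distinct directions with a common origin
span a cube. -/
theorem IsCoveredByTrees.exists_cube {X : CubeComplex.{u} k} {n : Fin k → ℕ}
    (hX : X.IsCoveredByTrees n) {S : Finset (Fin k)} (v : X.Vertex)
    (e : ∀ i, i ∈ S → X.OrientedEdge i) (he : ∀ i hi, X.origin (e i hi) = v) :
    ∃ c : X.Cube S, X.corner c = v ∧ ∀ i hi, X.edge c hi = e i hi := by
  obtain ⟨V, T, -, p, hs, hp⟩ := hX
  obtain ⟨z, rfl⟩ := hs v
  have h1 : ∀ i hi, ∃ b : (prodGraph T).OrientedEdge i,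
      (prodGraph T).corner b = z ∧ p.toFun b = e i hi := fun i hi =>
    (hp {i} z (e i hi) (he i hi)).exists
  choose b hb hb' using h1
  obtain ⟨c, hc, hc'⟩ := prodGraph_exists z b hb
  refine ⟨p.toFun c, ?_, fun i hi => ?_⟩
  · rw [← p.map_corner, hc]
  · rw [← p.map_edge, hc', hb']

theorem IsCoveredByTrees.finite_edges {X : CubeComplex.{u} k} {n : Fin k → ℕ}
    (hX : X.IsCoveredByTrees n) [Finite X.Vertex] (i : Fin k) : Finite (X.OrientedEdge i) := by
  obtain ⟨V, T, hT, p, hs, hp⟩ := hX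
  choose z hz using hs
  have hfin : ∀ v, Finite ((T i).neighborSet ((z v).1.1 i)) := fun v =>
    Set.finite_of_encard_eq_coe ((hT i).2 _)
  have h1 : ∀ e : X.OrientedEdge i, ∃ b : (prodGraph T).OrientedEdge i,
      (prodGraph T).corner b = z (X.origin e) ∧ p.toFun b = e := fun e =>
    (hp {i} _ e (hz _).symm).exists
  choose b hb hb' using h1
  let f : X.OrientedEdge i → Σ v : X.Vertex, (T i).neighborSet ((z v).1.1 i) := fun e =>
    ⟨X.origin e, (b e).1.2 i, by
      have h := ((b e).2 i).1 (by simp)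
      rw [← prodGraph_corner_fst, hb] at h
      exact h⟩
  refine Finite.of_injective f fun e e' h => ?_
  have h0 : X.origin e = X.origin e' := congrArg Sigma.fst h
  have h2 : (b e).1.2 i = (b e').1.2 i :=
    congrArg (fun q : Σ v : X.Vertex, (T i).neighborSet ((z v).1.1 i) => (q.2 : V i)) h
  rw [← hb' e, ← hb' e']
  congr 1
  refine prodGraph_ext _ _ (by rw [hb, hb, h0]) fun j hj => ?_
  obtain rfl := Finset.mem_singleton.mp hj
  exact h2

/-- All oriented edges of a cube complex, with their direction as colour. -/
abbrev ColouredEdge (X : CubeComplex.{u} k) : Type u := Σ i : Fin k, X.OrientedEdge i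

/-- The paths `p = xy` and `q = y'x'` of length two run along the boundary of a common square from
a corner to the opposite one: for a cornered square `c` with directions `i ≠ j`, `p` goes first
along direction `i` and then along `j`, and `q` goes first along `j` and then along `i`. -/
def IsSquare (X : CubeComplex.{u} k) (p q : X.ColouredEdge × X.ColouredEdge) : Prop :=
  ∃ (i j : Fin k) (c : X.Cube {i, j}), i ≠ j ∧
    p = (⟨i, X.edge c (Finset.mem_insert_self i {j})⟩,
      ⟨j, X.edge (X.flip {i} c) (Finset.mem_insert_of_mem (Finset.mem_singleton_self j))⟩) ∧
    q = (⟨j, X.edge c (Finset.mem_insert_of_mem (Finset.mem_singleton_self j))⟩,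
      ⟨i, X.edge (X.flip {j} c) (Finset.mem_insert_self i {j})⟩)

theorem isSquare_of_cube (X : CubeComplex.{u} k) {S : Finset (Fin k)} (c : X.Cube S) {i j : Fin k}
    (hij : i ≠ j) (hi : i ∈ S) (hj : j ∈ S) :
    X.IsSquare (⟨i, X.edge c hi⟩, ⟨j, X.edge (X.flip {i} c) hj⟩)
      (⟨j, X.edge c hj⟩, ⟨i, X.edge (X.flip {j} c) hi⟩) := by
  have hS : ({i, j} : Finset (Fin k)) ⊆ S := by
    intro a ha
    rcases Finset.mem_insert.mp ha with rfl | ha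
    · exact hi
    · rwa [Finset.mem_singleton.mp ha]
  refine ⟨i, j, X.face hS c, hij, ?_, ?_⟩
  · rw [← X.face_flip hS {i} c (by simp), edge_face, edge_face]
  · rw [← X.face_flip hS {j} c (by simp), edge_face, edge_face]

theorem IsSquare.symm {X : CubeComplex.{u} k} {p q : X.ColouredEdge × X.ColouredEdge}
    (h : X.IsSquare p q) : X.IsSquare q p := by
  obtain ⟨i, j, c, hij, rfl, rfl⟩ := h
  exact X.isSquare_of_cube c hij.symm _ _

theorem IsSquare.ends {X : CubeComplex.{u} k} {p q : X.ColouredEdge × X.ColouredEdge}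
    (h : X.IsSquare p q) : q.1.1 = p.2.1 ∧ q.2.1 = p.1.1 ∧
      X.origin q.1.2 = X.origin p.1.2 ∧ X.terminus q.2.2 = X.terminus p.2.2 := by
  obtain ⟨i, j, c, hij, rfl, rfl⟩ := h
  refine ⟨rfl, rfl, ?_, ?_⟩
  · simp only [origin_edge]
  · simp only [terminus_edge]
    rw [flip_comm]

theorem IsSquare.bicoloured {X : CubeComplex.{u} k} {p q : X.ColouredEdge × X.ColouredEdge}
    (h : X.IsSquare p q) : X.terminus p.1.2 = X.origin p.2.2 ∧ p.1.1 ≠ p.2.1 := by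
  obtain ⟨i, j, c, hij, rfl, rfl⟩ := h
  exact ⟨by simp only [origin_edge, terminus_edge], hij⟩

theorem reverse_reverse (X : CubeComplex.{u} k) {i : Fin k} (e : X.OrientedEdge i) :
    X.reverse (X.reverse e) = e := X.flip_flip_self _ e

theorem IsCoveredByTrees.isSquare_unique {X : CubeComplex.{u} k} {n : Fin k → ℕ}
    (hX : X.IsCoveredByTrees n) {p q q' : X.ColouredEdge × X.ColouredEdge}
    (h : X.IsSquare p q) (h' : X.IsSquare p q') : q = q' := by
  obtain ⟨i, j, c, hij, rfl, rfl⟩ := h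
  obtain ⟨i', j', c', hij', hp, rfl⟩ := h'
  obtain rfl : i = i' := congrArg (fun p => p.1.1) hp
  obtain rfl : j = j' := congrArg (fun p => p.2.1) hp
  have h1 := eq_of_heq (Sigma.mk.inj (Prod.mk.inj hp).1).2
  have h2 := eq_of_heq (Sigma.mk.inj (Prod.mk.inj hp).2).2
  have hc : X.flip {i} c = X.flip {i} c' := by
    refine hX.cube_ext _ _ ?_ fun a ha => ?_
    · rw [← X.origin_edge _ (Finset.mem_insert_of_mem (Finset.mem_singleton_self j)), h2,
        X.origin_edge]
    · rcases Finset.mem_insert.mp ha with rfl | ha'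
      · rw [X.edge_flip_self, X.edge_flip_self, h1]
      · obtain rfl := Finset.mem_singleton.mp ha'
        exact h2
  obtain rfl : c = c' := by rw [← X.flip_flip_self {i} c, hc, X.flip_flip_self]
  rfl

theorem IsCoveredByTrees.exists_isSquare {X : CubeComplex.{u} k} {n : Fin k → ℕ}
    (hX : X.IsCoveredByTrees n) {x y : X.ColouredEdge} (h : X.terminus x.2 = X.origin y.2)
    (hxy : x.1 ≠ y.1) : ∃ q, X.IsSquare (x, y) q := by
  obtain ⟨i, x⟩ := x
  obtain ⟨j, y⟩ := y
  change i ≠ j at hxy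
  have hcases : ∀ a, a ∈ ({i, j} : Finset (Fin k)) → a ≠ i → a = j := fun a ha hai =>
    Finset.mem_singleton.mp ((Finset.mem_insert.mp ha).resolve_left hai)
  obtain ⟨c, -, hc'⟩ := hX.exists_cube (S := {i, j}) (X.origin y)
    (fun a ha => if hai : a = i then hai ▸ X.reverse x else (hcases a ha hai) ▸ y)
    (fun a ha => by
      by_cases hai : a = i
      · subst hai
        simpa [origin, terminus] using h
      · obtain rfl := hcases a ha hai
        simp [hai])
  have h1 := hc' i (Finset.mem_insert_self i {j})
  have h2 := hc' j (Finset.mem_insert_of_mem (Finset.mem_singleton_self j))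
  simp only [dif_pos] at h1
  simp only [dif_neg hxy.symm] at h2
  refine ⟨_, i, j, X.flip {i} c, hxy, Prod.ext ?_ ?_, rfl⟩
  · simp only [X.edge_flip_self, h1, X.reverse_reverse]
  · simp only [X.flip_flip_self, h2]

open Classical in
/-- The bijection `φ` of a complex covered by a product of trees: it takes a bicoloured path of
length two to the opposite one in the unique square containing it. -/
noncomputable def oppositePath (X : CubeComplex.{u} k) {n : Fin k → ℕ}
    (hX : X.IsCoveredByTrees n)
    (p : BicolouredPath (V := X.Vertex) (E := X.ColouredEdge) (fun e => X.origin e.2)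
      (fun e => X.terminus e.2) (fun e => e.1)) :
    BicolouredPath (V := X.Vertex) (E := X.ColouredEdge) (fun e => X.origin e.2)
      (fun e => X.terminus e.2) (fun e => e.1) :=
  ⟨(hX.exists_isSquare p.2.1 p.2.2).choose,
    (hX.exists_isSquare p.2.1 p.2.2).choose_spec.symm.bicoloured⟩

theorem isSquare_oppositePath (X : CubeComplex.{u} k) {n : Fin k → ℕ}
    (hX : X.IsCoveredByTrees n)
    (p : BicolouredPath (V := X.Vertex) (E := X.ColouredEdge) (fun e => X.origin e.2)
      (fun e => X.terminus e.2) (fun e => e.1)) :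
    X.IsSquare p.1 (X.oppositePath hX p).1 :=
  (hX.exists_isSquare p.2.1 p.2.2).choose_spec

/-- Three consecutive edges of distinct directions lie on a common three-dimensional cube. -/
theorem IsCoveredByTrees.exists_three_cube {X : CubeComplex.{u} k} {n : Fin k → ℕ}
    (hX : X.IsCoveredByTrees n) {i j l : Fin k} (hij : i ≠ j) (hil : i ≠ l) (hjl : j ≠ l)
    (x : X.OrientedEdge i) (y : X.OrientedEdge j) (z : X.OrientedEdge l)
    (h : X.terminus x = X.origin y) (h' : X.terminus y = X.origin z) :
    ∃ (S : Finset (Fin k)) (c : X.Cube S) (hi : i ∈ S) (hj : j ∈ S) (hl : l ∈ S),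
      x = X.edge c hi ∧ y = X.edge (X.flip {i} c) hj ∧
        z = X.edge (X.flip {j} (X.flip {i} c)) hl := by
  obtain ⟨q, hq⟩ := hX.exists_isSquare (x := ⟨i, x⟩) (y := ⟨j, y⟩) h hij
  obtain ⟨i', j', s, -, hp, -⟩ := hq
  obtain rfl : i = i' := congrArg (fun p => p.1.1) hp
  obtain rfl : j = j' := congrArg (fun p => p.2.1) hp
  have h1 := eq_of_heq (Sigma.mk.inj (Prod.mk.inj hp).1).2
  have h2 := eq_of_heq (Sigma.mk.inj (Prod.mk.inj hp).2).2
  set s' := X.flip {j} (X.flip {i} s) with hs'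
  have hsz : X.corner s' = X.origin z := by
    rw [← h', h2, X.terminus_edge]
  have hcases : ∀ a, a ∈ ({i, j, l} : Finset (Fin k)) → a ≠ l → a ∈ ({i, j} : Finset (Fin k)) := by
    intro a ha hal
    simp only [Finset.mem_insert, Finset.mem_singleton] at ha ⊢
    tauto
  obtain ⟨c, hc, hc'⟩ := hX.exists_cube (S := {i, j, l}) (X.origin z)
    (fun a ha => if hal : a = l then hal ▸ z else X.edge s' (hcases a ha hal))
    (fun a ha => by
      by_cases hal : a = l
      · subst hal
        simp
      · simp only [dif_neg hal, X.origin_edge, hsz])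
  have hsub : ({i, j} : Finset (Fin k)) ⊆ {i, j, l} := by
    intro a ha
    simp only [Finset.mem_insert, Finset.mem_singleton] at ha ⊢
    tauto
  have hface : X.face hsub c = s' := by
    refine hX.cube_ext _ _ (by rw [corner_face, hc, hsz]) fun a ha => ?_
    rw [edge_face, hc']
    have hal : a ≠ l := by
      rintro rfl
      simp only [Finset.mem_insert, Finset.mem_singleton] at ha
      rcases ha with rfl | rfl
      · exact hil rfl
      · exact hjl rfl
    rw [dif_neg hal]
  have hs : s = X.face hsub (X.flip {i} (X.flip {j} c)) := by
    rw [X.face_flip _ _ _ (by simp), X.face_flip _ _ _ (by simp), hface, hs', X.flip_flip_self,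
      X.flip_flip_self]
  refine ⟨{i, j, l}, X.flip {i} (X.flip {j} c), by simp, by simp, by simp, ?_, ?_, ?_⟩
  · rw [h1, hs, edge_face]
  · rw [h2, hs, ← X.face_flip _ _ _ (by simp), edge_face]
  · rw [X.flip_flip_self, X.flip_flip_self, hc', dif_pos rfl]

/-- The `k`-dimensional digraph `DG(X)` of a complex `X` with finitely many vertices covered by a
product of trees: the vertices are those of `X`, the edges of colour `i` are the oriented edges of
direction `i` (two of opposite orientation for each geometric edge), and `φ` is read off from the
squares of `X`. -/
noncomputable def digraph (X : CubeComplex.{u} k) {n : Fin k → ℕ} (hX : X.IsCoveredByTrees n)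
    [Finite X.Vertex] : KDigraph.{u} k where
  V := X.Vertex
  E := X.ColouredEdge
  finite_V := inferInstance
  finite_E :=
    haveI := hX.finite_edges
    inferInstance
  o e := X.origin e.2
  t e := X.terminus e.2
  colour e := e.1
  φ := X.oppositePath hX
  φ_involutive p := Subtype.ext (hX.isSquare_unique (X.isSquare_oppositePath hX _)
    (X.isSquare_oppositePath hX p).symm)
  f1 p := (X.isSquare_oppositePath hX p).ends
  f2 := by
    rintro ⟨i, x⟩ ⟨j, y⟩ ⟨l, z⟩ x' x'' x₁ x₂ y' y'' y₁ y₂ z' z'' z₁ z₂ hxy hyz hij hil hjl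
      h1 h2 h3 h4 h5 h6
    have key : ∀ p q : X.ColouredEdge × X.ColouredEdge,
        (∃ h, (X.oppositePath hX ⟨p, h⟩).1 = q) → X.IsSquare p q := by
      rintro p _ ⟨h, rfl⟩
      exact X.isSquare_oppositePath hX ⟨p, h⟩
    have s1 := key _ _ h1
    have s2 := key _ _ h2
    have s3 := key _ _ h3
    have s4 := key _ _ h4
    have s5 := key _ _ h5
    have s6 := key _ _ h6
    clear h1 h2 h3 h4 h5 h6 key
    change i ≠ j at hij
    change i ≠ l at hil
    change j ≠ l at hjl
    obtain ⟨S, c, hi, hj, hl, rfl, rfl, rfl⟩ :=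
      hX.exists_three_cube hij hil hjl x y z hxy hyz
    obtain ⟨rfl, rfl⟩ := Prod.mk.inj (hX.isSquare_unique s1 (X.isSquare_of_cube c hij hi hj))
    rw [X.flip_comm {j} {i} c] at s2
    obtain ⟨rfl, rfl⟩ := Prod.mk.inj
      (hX.isSquare_unique s2 (X.isSquare_of_cube (X.flip {j} c) hil hi hl))
    obtain ⟨rfl, rfl⟩ := Prod.mk.inj (hX.isSquare_unique s3 (X.isSquare_of_cube c hjl hj hl))
    obtain ⟨rfl, rfl⟩ := Prod.mk.inj
      (hX.isSquare_unique s4 (X.isSquare_of_cube (X.flip {i} c) hjl hj hl))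
    obtain ⟨rfl, rfl⟩ := Prod.mk.inj (hX.isSquare_unique s5 (X.isSquare_of_cube c hil hi hl))
    rw [X.flip_comm {l} {i} c] at s6
    obtain ⟨rfl, rfl⟩ := Prod.mk.inj
      (hX.isSquare_unique s6 (X.isSquare_of_cube (X.flip {l} c) hij hi hj))
    exact ⟨by rw [X.flip_comm], rfl, rfl⟩

/-- The `k`-graph `Λ(X)` of a `k`-cube complex. -/
noncomputable def kGraph (X : CubeComplex.{u} k) {n : Fin k → ℕ} (hX : X.IsCoveredByTrees n)
    [Finite X.Vertex] : GradedCategory.{u} k :=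
  (X.digraph hX).toGradedCategory

noncomputable instance (X : CubeComplex.{u} k) {n : Fin k → ℕ} (hX : X.IsCoveredByTrees n)
    [Finite X.Vertex] : Fintype (X.kGraph hX).Obj :=
  inferInstanceAs (Fintype (X.digraph hX).toGradedCategory.Obj)

end CubeComplex

/-! Unique factorisation reduces to one cancellation law: if two morphisms ending in edges of the
same colour agree, then those last edges and the remaining prefixes agree (`Mor.snoc_inj`). To prove
it, fix a colour `i`, take the last edge of colour `i` on a path and carry it to the end by squares,
remembering the class of what precedes it. This `lastEdge i` is unchanged by diverting. When the
diverted square contains the carried edge, this is the involutivity of `φ`; when it lies entirely to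
the right of that edge, so that the edge must cross it, this is exactly the cube condition `D.f2`
(`Marked.push_push`). Hence `lastEdge i` descends to morphisms. On a morphism given as a prefix
followed by an edge of colour `i`, it returns that prefix and that edge.

Conversely, any colour occurring in the degree can be brought to the end (`Mor.exists_snoc`).
Peeling off edges one at a time then gives existence and uniqueness of factorisations by induction
on the length of the last factor.

Morphisms of degree `e_i` are single edges, so the coordinate matrices are adjacency matrices up to
transposition, and reversal of edges makes these symmetric. The covering is bijective on stars, so
row sums can be counted in the product of trees, where the edges of direction `i` at a vertex
correspond to the `n i` neighbours of its `i`-th coordinate. For a nonempty nonnegative matrix with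
constant row sum, Gershgorin's theorem bounds every eigenvalue by that sum, and the all-ones vector
attains it. -/

namespace KDigraph

variable {k : ℕ} {D : KDigraph.{u} k}

/-! ### Unique factorisation in the category of a `k`-dimensional digraph -/

variable (D) in
/-- The morphisms from `v` to `w` of the category of a `k`-dimensional digraph. -/
abbrev Mor (v w : D.V) : Type u := Quot (D.Divert (v := v) (w := w))

/-- Composition of a morphism with an edge. -/
def Mor.snoc {v u w : D.V} (f : D.Mor v u) (e : u ⟶ w) : D.Mor v w :=
  Quot.map (fun p : Quiver.Path v u => p.cons e) 
    (fun _ _ h => h.comp_right (Quiver.Path.nil.cons e)) f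

/-- Composition of morphisms. -/
def Mor.comp {v u w : D.V} (f : D.Mor v u) (g : D.Mor u w) : D.Mor v w :=
  Quot.map₂ Quiver.Path.comp (fun r _ _ h => h.comp_left r) (fun _ _ r h => h.comp_right r) f g

/-- The degree of a morphism. -/
def Mor.degree {v w : D.V} (f : D.Mor v w) : Fin k → ℕ :=
  Quot.lift (fun p : Quiver.Path v w => D.pathDegree p) (fun _ _ h => h.pathDegree_eq) f

theorem Mor.comp_snoc {v u u' w : D.V} (f : D.Mor v u) (g : D.Mor u u') (e : u' ⟶ w) :
    f.comp (g.snoc e) = (f.comp g).snoc e := by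
  obtain ⟨p⟩ := f
  obtain ⟨q⟩ := g
  rfl

theorem Mor.degree_snoc {v u w : D.V} (f : D.Mor v u) (e : u ⟶ w) :
    (f.snoc e).degree = f.degree + Pi.single (D.colour e.1) 1 := by
  obtain ⟨p⟩ := f
  rfl

theorem Mor.degree_comp {v u w : D.V} (f : D.Mor v u) (g : D.Mor u w) :
    (f.comp g).degree = f.degree + g.degree := by
  obtain ⟨p⟩ := f
  obtain ⟨q⟩ := g
  exact D.pathDegree_comp p q

/-! ### Squares as relations between typed edges -/

/-- A square relation `xy ∼ y'x'`, for edges of distinct colours. -/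
def Swap {a u u' b : D.V} (x : a ⟶ u) (y : u ⟶ b) (y' : a ⟶ u') (x' : u' ⟶ b) : Prop :=
  ∃ h, (D.φ ⟨(x.1, y.1), h⟩).1 = (y'.1, x'.1)

theorem exists_swap {a u b : D.V} (x : a ⟶ u) (y : u ⟶ b) (h : D.colour x.1 ≠ D.colour y.1) :
    ∃ (u' : D.V) (y' : a ⟶ u') (x' : u' ⟶ b), Swap x y y' x' := by
  let P : BicolouredPath D.o D.t D.colour := ⟨(x.1, y.1), x.2.2.trans y.2.1.symm, h⟩
  obtain ⟨-, -, h3, h4⟩ := D.f1 P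
  exact ⟨D.t (D.φ P).1.1, ⟨(D.φ P).1.1, h3.trans x.2.1, rfl⟩,
    ⟨(D.φ P).1.2, (D.φ P).2.1.symm, h4.trans y.2.2⟩, P.2, rfl⟩

section Swap

variable {a u u' b : D.V} {x : a ⟶ u} {y : u ⟶ b} {y' : a ⟶ u'} {x' : u' ⟶ b}

theorem Swap.colour (h : Swap x y y' x') :
    D.colour y'.1 = D.colour y.1 ∧ D.colour x'.1 = D.colour x.1 := by
  obtain ⟨h, hφ⟩ := h
  have h1 := D.f1 ⟨(x.1, y.1), h⟩
  rw [hφ] at h1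
  exact ⟨h1.1, h1.2.1⟩

theorem Swap.ne (h : Swap x y y' x') : D.colour x.1 ≠ D.colour y.1 := h.1.2

theorem Swap.symm (h : Swap x y y' x') : Swap y' x' x y := by
  obtain ⟨h, hφ⟩ := h
  have h3 : (⟨(y'.1, x'.1), hφ ▸ (D.φ ⟨(x.1, y.1), h⟩).2⟩ : BicolouredPath D.o D.t D.colour) =
      D.φ ⟨(x.1, y.1), h⟩ := Subtype.ext hφ.symm
  exact ⟨_, (congrArg (fun P => (D.φ P).1) h3).trans (congrArg Subtype.val (D.φ_involutive _))⟩

theorem Swap.snoc_snoc {v : D.V} (h : Swap x y y' x') (f : D.Mor v a) :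
    (f.snoc x).snoc y = (f.snoc y').snoc x' := by
  obtain ⟨p⟩ := f
  exact Quot.sound (Divert.mk p x y y' x' Quiver.Path.nil h)

end Swap

/-! ### Carrying an edge of a fixed colour to the end -/

/-- Morphisms from `v` to `w` with a chosen last edge, which has colour `i`. -/
abbrev Marked (i : Fin k) (v w : D.V) : Type u :=
  Σ u : D.V, D.Mor v u × {x : u ⟶ w // D.colour x.1 = i}

/-- Moving the last edge of colour `i` past a further edge of another colour. -/
noncomputable def Marked.push {i : Fin k} {v w w' : D.V} (a : Marked i v w) (e : w ⟶ w')
    (he : D.colour e.1 ≠ i) : Marked i v w' :=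
  have h := exists_swap a.2.2.1 e (a.2.2.2.trans_ne he.symm)
  ⟨h.choose, a.2.1.snoc h.choose_spec.choose, h.choose_spec.choose_spec.choose,
    h.choose_spec.choose_spec.choose_spec.colour.2.trans a.2.2.2⟩

/-- `push` picks its square by choice, but `φ` is a function, so the two new edges are forced and
any square at hand computes `push`. -/
theorem Marked.push_eq {i : Fin k} {v u u' w w' : D.V} (f : D.Mor v u) {x : u ⟶ w}
    (hx : D.colour x.1 = i) {e : w ⟶ w'} (he : D.colour e.1 ≠ i) {e' : u ⟶ u'} {x' : u' ⟶ w'}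
    (hx' : D.colour x'.1 = i) (h : Swap x e e' x') :
    Marked.push ⟨u, f, x, hx⟩ e he = ⟨u', f.snoc e', x', hx'⟩ := by
  have key : ∀ {u'' : D.V} {e'' : u ⟶ u''} {x'' : u'' ⟶ w'} (hx'' : D.colour x''.1 = i),
      Swap x e e'' x'' → (⟨u'', f.snoc e'', x'', hx''⟩ : Marked i v w') =
        ⟨u', f.snoc e', x', hx'⟩ := by
    intro u'' e'' x'' hx'' h'
    obtain ⟨h1, h2⟩ := Prod.mk.inj (h'.2.symm.trans h.2)
    -- The edges agree only as elements of `D.E`. Destructuring makes the intermediate vertices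
    -- terminal points of edges, so that equal edges identify them too.
    obtain ⟨e'', ho, rfl⟩ := e''
    obtain ⟨e', ho', rfl⟩ := e'
    obtain ⟨x'', hxo, hxt⟩ := x''
    obtain ⟨x', hxo', hxt'⟩ := x'
    change e'' = e' at h1
    change x'' = x' at h2
    subst h1 h2
    rfl
  exact key _ (exists_swap x e (hx.trans_ne he.symm)).choose_spec.choose_spec.choose_spec

/-- This is where the cube condition enters: the marked edge and the two sides of the square have
three distinct colours. The two routes yield the same marked edge, and prefixes that differ by a
square. -/
theorem Marked.push_push {i : Fin k} {v w : D.V} (a : Marked i v w) {u u' b : D.V} {y : w ⟶ u}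
    {z : u ⟶ b} {z₁ : w ⟶ u'} {y₁ : u' ⟶ b} (h : Swap y z z₁ y₁) (hy : D.colour y.1 ≠ i)
    (hz : D.colour z.1 ≠ i) (hz₁ : D.colour z₁.1 ≠ i) (hy₁ : D.colour y₁.1 ≠ i) :
    (a.push y hy).push z hz = (a.push z₁ hz₁).push y₁ hy₁ := by
  obtain ⟨a, f, x, hx⟩ := a
  obtain ⟨b₁, y', x', h1⟩ := exists_swap x y (hx.trans_ne hy.symm)
  have hx' := h1.colour.2.trans hx
  obtain ⟨b₂, z', x'', h2⟩ := exists_swap x' z (hx'.trans_ne hz.symm)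
  have hx'' := h2.colour.2.trans hx'
  -- The opposite face of the cube: this square turns the prefix of the first route into that of the
  -- second.
  obtain ⟨b₃, z'', y'', h3⟩ := exists_swap y' z' (by
    rw [h1.colour.1, h2.colour.1]; exact h.ne)
  obtain ⟨b₄, z₂, x₁, h4⟩ := exists_swap x z₁ (hx.trans_ne hz₁.symm)
  have hx₁ := h4.colour.2.trans hx
  obtain ⟨b₅, y₂, x₂, h5⟩ := exists_swap x₁ y₁ (hx₁.trans_ne hy₁.symm)
  have hx₂ := h5.colour.2.trans hx₁
  rw [push_eq f hx hy hx' h1, push_eq _ hx' hz hx'' h2, push_eq f hx hz₁ hx₁ h4,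
    push_eq _ hx₁ hy₁ hx₂ h5, h3.snoc_snoc]
  obtain ⟨e1, e2, e3⟩ := D.f2 x.1 y.1 z.1 x'.1 x''.1 x₁.1 x₂.1 y'.1 y''.1 y₁.1 y₂.1 z'.1 z''.1
    z₁.1 z₂.1 (x.2.2.trans y.2.1.symm) (y.2.2.trans z.2.1.symm) (hx.trans_ne hy.symm)
    (hx.trans_ne hz.symm) h.ne h1 h2 h3 h h4 h5
  obtain ⟨z'', hzo, rfl⟩ := z''
  obtain ⟨z₂, hzo', rfl⟩ := z₂
  obtain ⟨x'', hxo, hxt⟩ := x''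
  obtain ⟨x₂, hxo', hxt'⟩ := x₂
  obtain ⟨y'', hyo, hyt⟩ := y''
  obtain ⟨y₂, hyo', hyt'⟩ := y₂
  dsimp only at e1 e2 e3
  subst e1 e2 e3
  subst hxo hxo'
  rfl

open Classical in
/-- The last edge of colour `i` of a path, moved to the end of the path. -/
noncomputable def lastEdge (i : Fin k) {v : D.V} :
    ∀ {w : D.V}, Quiver.Path v w → Option (Marked i v w)
  | _, .nil => none
  | _, .cons p e =>
    if h : D.colour e.1 = i then some ⟨_, Quot.mk _ p, e, h⟩
    else (lastEdge i p).map fun a => a.push e h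

theorem lastEdge_cons_of_eq {i : Fin k} {v u w : D.V} (p : Quiver.Path v u) (e : u ⟶ w)
    (h : D.colour e.1 = i) :
    lastEdge i (p.cons e) = some ⟨u, Quot.mk _ p, e, h⟩ := by
  simp [lastEdge, h]

theorem lastEdge_cons_of_ne {i : Fin k} {v u w : D.V} (p : Quiver.Path v u) (e : u ⟶ w)
    (h : D.colour e.1 ≠ i) :
    lastEdge i (p.cons e) = (lastEdge i p).map fun a => a.push e h := by
  simp [lastEdge, h]

/-- If one side of the square has colour `i`, one path ends in the marked edge already and the other
reaches it by pushing across this very square. If neither has, the marked edge comes from `p` and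
`Marked.push_push` applies. -/
theorem lastEdge_swap (i : Fin k) {v a u u' b : D.V} (p : Quiver.Path v a) {x : a ⟶ u}
    {y : u ⟶ b} {y' : a ⟶ u'} {x' : u' ⟶ b} (h : Swap x y y' x') :
    lastEdge i ((p.cons x).cons y) = lastEdge i ((p.cons y').cons x') := by
  -- The case where `x` has colour `i` is this one for the reversed square.
  have key : ∀ {u u' : D.V} {x : a ⟶ u} {y : u ⟶ b} {y' : a ⟶ u'} {x' : u' ⟶ b},
      Swap x y y' x' → D.colour y.1 = i →
      lastEdge i ((p.cons x).cons y) = lastEdge i ((p.cons y').cons x') := by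
    intro u u' x y y' x' h hy
    have hx' : D.colour x'.1 ≠ i := by
      rw [h.colour.2, ← hy]
      exact h.ne
    rw [lastEdge_cons_of_eq _ _ hy, lastEdge_cons_of_ne _ _ hx',
      lastEdge_cons_of_eq _ _ (h.colour.1.trans hy), Option.map_some,
      Marked.push_eq _ _ hx' hy h.symm]
    rfl
  by_cases hy : D.colour y.1 = i
  · exact key h hy
  by_cases hx : D.colour x.1 = i
  · exact (key h.symm (h.colour.2.trans hx)).symm
  have hy' : D.colour y'.1 ≠ i := by rwa [h.colour.1]
  have hx' : D.colour x'.1 ≠ i := by rwa [h.colour.2]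
  rw [lastEdge_cons_of_ne _ _ hy, lastEdge_cons_of_ne _ _ hx, lastEdge_cons_of_ne _ _ hx',
    lastEdge_cons_of_ne _ _ hy', Option.map_map, Option.map_map]
  congr 1
  funext a
  exact a.push_push h hx hy hy' hx'

/-- Induction on the part after the diverted square. An edge of colour `i` there stops the search,
leaving prefixes that are already equal as classes; any other edge pushes equal data. -/
theorem Divert.lastEdge_eq (i : Fin k) {v w : D.V} {p q : Quiver.Path v w} (h : D.Divert p q) :
    lastEdge i p = lastEdge i q := by
  obtain ⟨p, x, y, y', x', q, h⟩ := h
  induction q with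
  | nil => exact lastEdge_swap i p h
  | cons q e ih =>
    rw [Quiver.Path.comp_cons, Quiver.Path.comp_cons]
    by_cases he : D.colour e.1 = i
    · rw [lastEdge_cons_of_eq _ _ he, lastEdge_cons_of_eq _ _ he,
        Quot.sound (Divert.mk p x y y' x' q h)]
    · rw [lastEdge_cons_of_ne _ _ he, lastEdge_cons_of_ne _ _ he, ih]

/-! ### Cancellation and factorisation -/

/-- Right cancellation: the invariant `lastEdge`, descended to classes, reads the final edge and its
prefix off either side. -/
theorem Mor.snoc_inj {v u u' w : D.V} {f : D.Mor v u} {f' : D.Mor v u'} {x : u ⟶ w}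
    {x' : u' ⟶ w} (hx : D.colour x.1 = D.colour x'.1) (h : f.snoc x = f'.snoc x') :
    (⟨u, f, x⟩ : Σ u : D.V, D.Mor v u × (u ⟶ w)) = ⟨u', f', x'⟩ := by
  obtain ⟨p⟩ := f
  obtain ⟨p'⟩ := f'
  have h1 := congrArg (Quot.lift (lastEdge (D.colour x'.1)) fun _ _ h => h.lastEdge_eq _) h
  change lastEdge _ (p.cons x) = lastEdge _ (p'.cons x') at h1
  rw [lastEdge_cons_of_eq _ _ hx, lastEdge_cons_of_eq _ _ rfl, Option.some_inj] at h1
  exact congrArg (fun a : Marked (D.colour x'.1) v w =>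
    (⟨a.1, a.2.1, a.2.2.1⟩ : Σ u : D.V, D.Mor v u × (u ⟶ w))) h1

/-- An edge of colour `i` is moved rightwards past each later edge of another colour by a square. -/
theorem Mor.exists_snoc {v w : D.V} (f : D.Mor v w) {i : Fin k} (hi : 0 < f.degree i) :
    ∃ (u : D.V) (g : D.Mor v u) (x : u ⟶ w), D.colour x.1 = i ∧ f = g.snoc x := by
  obtain ⟨p⟩ := f
  induction p with
  | nil => exact absurd hi (lt_irrefl 0)
  | @cons b c p e ih =>
    by_cases he : D.colour e.1 = i
    · exact ⟨b, Quot.mk _ p, e, he, rfl⟩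
    · change 0 < D.pathDegree p i + (Pi.single (D.colour e.1) 1 : Fin k → ℕ) i at hi
      rw [Pi.single_eq_of_ne' he, add_zero] at hi
      obtain ⟨u, g, x, hx, hg⟩ := ih (Quot.mk _ p) hi
      obtain ⟨u', e', x', h⟩ := exists_swap x e (hx.trans_ne (Ne.symm he))
      refine ⟨u', g.snoc e', x', h.colour.2.trans hx, ?_⟩
      rw [← h.snoc_snoc, ← hg]
      rfl

theorem Mor.eq_id_of_degree_eq_zero {v w : D.V} (f : D.Mor v w) (hf : f.degree = 0) :
    ∃ h : v = w, h ▸ f = (Quot.mk _ Quiver.Path.nil : D.Mor w w) := by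
  obtain ⟨p⟩ := f
  cases p with
  | nil => exact ⟨rfl, rfl⟩
  | cons p e =>
    have h := congrFun hf (D.colour e.1)
    change D.pathDegree p _ + (Pi.single (D.colour e.1) 1 : Fin k → ℕ) _ = 0 at h
    simp at h

/-- Induction on the length of the final factor `μ`. A colour in its degree is also a colour of `f`,
so an edge of that colour can be peeled off the end of both. -/
theorem Mor.existsUnique_factorisation {v w : D.V} (f : D.Mor v w) (m n : Fin k → ℕ)
    (h : f.degree = m + n) :
    ∃! q : Σ u : D.V, D.Mor v u × D.Mor u w,
      q.2.1.comp q.2.2 = f ∧ q.2.2.degree = m ∧ q.2.1.degree = n := by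
  induction hs : ∑ i, m i generalizing w m with
  | zero =>
    obtain rfl : m = 0 := funext fun i => Finset.sum_eq_zero_iff.mp hs i (Finset.mem_univ i)
    refine ⟨⟨w, f, Quot.mk _ Quiver.Path.nil⟩, ⟨?_, rfl, by rw [h, zero_add]⟩, ?_⟩
    · obtain ⟨p⟩ := f
      rfl
    · rintro ⟨u, ν, μ⟩ ⟨h1, h2, h3⟩
      obtain ⟨hu, hμ⟩ := μ.eq_id_of_degree_eq_zero h2
      subst hu
      dsimp only at hμ h1
      subst hμ
      subst h1
      obtain ⟨p⟩ := ν
      rfl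
  | succ s ih =>
    obtain ⟨i, hi⟩ : ∃ i, 0 < m i := by
      by_contra! hm
      rw [Finset.sum_eq_zero fun i _ => Nat.le_zero.mp (hm i)] at hs
      omega
    obtain ⟨m', rfl⟩ : ∃ m' : Fin k → ℕ, m = m' + Pi.single i 1 := by
      refine ⟨m - Pi.single i 1, (tsub_add_cancel_of_le fun j => ?_).symm⟩
      by_cases hj : j = i
      · subst hj
        simpa using Nat.succ_le_of_lt hi
      · simp [hj]
    obtain ⟨b, g, x, hx, rfl⟩ := f.exists_snoc (i := i) (by
      rw [h]
      simp)
    have hg : g.degree = m' + n := by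
      rw [degree_snoc, hx, add_right_comm] at h
      exact add_right_cancel h
    have hs' : ∑ i, m' i = s := by
      simpa [Finset.sum_add_distrib] using hs
    obtain ⟨⟨u, ν, μ⟩, ⟨h1, h2, h3⟩, huniq⟩ := ih g m' hg hs'
    refine ⟨⟨u, ν, μ.snoc x⟩, ⟨?_, ?_, h3⟩, ?_⟩
    · exact (comp_snoc ν μ x).trans (congrArg (fun f : D.Mor v b => f.snoc x) h1)
    · exact (degree_snoc μ x).trans (by rw [hx]; exact congrArg (· + _) h2)
    · rintro ⟨u', ν', μ'⟩ ⟨h1', h2', h3'⟩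
      dsimp only at h1' h2' h3'
      -- The competing final factor is also made to end in colour `i`; cancellation identifies its
      -- last edge with `x`, and the induction hypothesis treats the rest.
      obtain ⟨b', μ'', x', hx', rfl⟩ := μ'.exists_snoc (i := i) (by
        rw [h2']
        simp)
      rw [comp_snoc] at h1'
      have h4 := snoc_inj (hx'.trans hx.symm) h1'
      obtain rfl : b' = b := congrArg Sigma.fst h4
      obtain ⟨h5, rfl⟩ := Prod.mk.inj (eq_of_heq (Sigma.mk.inj h4).2)
      rw [degree_snoc, hx] at h2'
      have h6 := huniq ⟨u', ν', μ''⟩ ⟨h5, add_right_cancel h2', h3'⟩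
      obtain rfl : u' = u := congrArg Sigma.fst h6
      obtain ⟨rfl, rfl⟩ := Prod.mk.inj (eq_of_heq (Sigma.mk.inj h6).2)
      rfl

/-! ### Countability -/

/-- The edges of a path, the last one first. -/
def edgeList {v : D.V} : ∀ {w : D.V}, Quiver.Path v w → List D.E
  | _, .nil => []
  | _, .cons p e => e.1 :: edgeList p

/-- The terminus is not fixed in advance, so the list must recover it too: it is the terminus of the
head, or `v` for the empty list. -/
theorem edgeList_injective {v w w' : D.V} (p : Quiver.Path v w) (p' : Quiver.Path v w')
    (h : edgeList p = edgeList p') :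
    (⟨w, p⟩ : Σ w : D.V, Quiver.Path v w) = ⟨w', p'⟩ := by
  induction p generalizing w' with
  | nil =>
    cases p' with
    | nil => rfl
    | cons p' e' => cases h
  | cons p e ih =>
    cases p' with
    | nil => cases h
    | cons p' e' =>
      obtain ⟨h1, h2⟩ := List.cons.inj h
      have h3 := ih p' h2
      cases h3
      obtain ⟨e, ho, rfl⟩ := e
      obtain ⟨e', ho', rfl⟩ := e'
      change e = e' at h1
      subst h1
      rfl

theorem countable_mor (D : KDigraph.{u} k) : Countable (Σ (v : D.V) (w : D.V), D.Mor v w) := by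
  have := D.finite_V
  have := D.finite_E
  have h1 : ∀ v : D.V, Countable (Σ w : D.V, Quiver.Path v w) := fun v =>
    Function.Injective.countable (f := fun a : Σ w : D.V, Quiver.Path v w => edgeList a.2)
      fun a b h => edgeList_injective a.2 b.2 h
  have h2 : ∀ v w : D.V, Countable (Quiver.Path v w) := fun v w =>
    Function.Injective.countable (f := fun p => (⟨w, p⟩ : Σ w : D.V, Quiver.Path v w))
      fun a b h => eq_of_heq (Sigma.mk.inj h).2
  have h3 : ∀ v w : D.V, Countable (D.Mor v w) := fun v w => Quot.mk_surjective.countable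
  infer_instance

/-- The category of a `k`-dimensional digraph is a `k`-graph. -/
theorem isKGraph (D : KDigraph.{u} k) : D.toGradedCategory.IsKGraph where
  countable := D.countable_mor
  d_comp {_ _ _} ν μ := (Mor.degree_comp (D := D) ν μ).trans (add_comm _ _)
  factorisation {_ _} f m n h := Mor.existsUnique_factorisation (D := D) f m n h

/-! ### Coordinate matrices and spectral radius -/

/-- The morphisms of degree `e_i` are the edges of colour `i`. -/
theorem coordinateMatrix_apply (D : KDigraph.{u} k) (i : Fin k) (v w : D.V) :
    D.toGradedCategory.coordinateMatrix i v w =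
      Nat.card {e : D.E // D.colour e = i ∧ D.o e = w ∧ D.t e = v} := by
  change Nat.card {f : D.Mor w v // f.degree = Pi.single i 1} = _
  symm
  refine Nat.card_congr (Equiv.ofBijective
    (fun e => ⟨Mor.snoc (Quot.mk _ .nil) ⟨e.1, e.2.2⟩, ?_⟩) ?_)
  · rw [Mor.degree_snoc, e.2.1]
    exact zero_add _
  · constructor
    · rintro ⟨e, he⟩ ⟨e', he'⟩ h
      -- Cancellation after the empty path: distinct edges of one colour are distinct morphisms.
      have h1 := Mor.snoc_inj (f := Quot.mk _ .nil) (f' := Quot.mk _ .nil)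
        (x := ⟨e, he.2⟩) (x' := ⟨e', he'.2⟩) (he.1.trans he'.1.symm) (congrArg Subtype.val h)
      have h2 := (Prod.mk.inj (eq_of_heq (Sigma.mk.inj h1).2)).2
      exact Subtype.ext (Subtype.ext_iff.mp h2 : e = e')
    · rintro ⟨f, hf⟩
      obtain ⟨u, g, x, hx, rfl⟩ := f.exists_snoc (i := i) (by rw [hf]; simp)
      rw [Mor.degree_snoc, hx] at hf
      obtain ⟨hu, hg⟩ := g.eq_id_of_degree_eq_zero (add_eq_right.mp hf)
      subst hu
      dsimp only at hg
      subst hg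
      exact ⟨⟨x.1, hx, x.2⟩, rfl⟩

end KDigraph
/-- The spectral radius of a matrix of natural numbers with constant row sums. -/
theorem spectralRadius_map_natCast_of_row_sum {ι : Type*} [Fintype ι] [DecidableEq ι] [Nonempty ι]
    (A : Matrix ι ι ℕ) (n : ℕ) (hA : ∀ i, ∑ j, A i j = n) :
    spectralRadius ℂ (A.map (fun a : ℕ => (a : ℂ))) = n := by
  set B := A.map (fun a : ℕ => (a : ℂ)) with hB
  have hspec : ∀ μ, μ ∈ spectrum ℂ B ↔ Module.End.HasEigenvalue (Matrix.toLin' B) μ := by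
    intro μ
    rw [Module.End.hasEigenvalue_iff_mem_spectrum, Matrix.spectrum_toLin']
  apply le_antisymm
  · refine iSup₂_le fun μ hμ => ?_
    -- Gershgorin: `μ` lies in a disc about some `B i i` whose radius is the off-diagonal row sum.
    obtain ⟨i, hi⟩ := eigenvalue_mem_ball ((hspec μ).mp hμ)
    rw [mem_closedBall_iff_norm] at hi
    have h1 : ‖μ‖ ≤ n := calc
      ‖μ‖ ≤ ‖μ - B i i‖ + ‖B i i‖ := norm_le_norm_sub_add _ _
      _ ≤ (∑ j ∈ Finset.univ.erase i, ‖B i j‖) + ‖B i i‖ := by gcongr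
      _ = ∑ j, ‖B i j‖ := Finset.sum_erase_add _ _ (Finset.mem_univ i)
      _ = n := by
        rw [← hA i]
        simp [hB]
    have h2 : ‖μ‖₊ ≤ (n : NNReal) := by exact_mod_cast h1
    exact_mod_cast h2
  · have h1 : (n : ℂ) ∈ spectrum ℂ B := by
      rw [hspec]
      -- The all-ones vector is an eigenvector; it is nonzero because `ι` is nonempty.
      refine Module.End.hasEigenvalue_of_hasEigenvector (x := fun _ => 1)
        ⟨Module.End.mem_eigenspace_iff.mpr ?_, fun h =>
          one_ne_zero (congrFun h (Classical.arbitrary ι))⟩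
      funext i
      simp [Matrix.mulVec, dotProduct, hB, ← hA i]
    refine le_trans ?_ (le_iSup₂ (f := fun (μ : ℂ) (_ : μ ∈ spectrum ℂ B) => (‖μ‖₊ : ℝ≥0∞)) _ h1)
    simp

/-! ### Adjacency matrices of a covered complex -/

namespace CubeComplex

variable {k : ℕ}

theorem adjacencyMatrix_symm (X : CubeComplex.{u} k) (i : Fin k) (v w : X.Vertex) :
    X.adjacencyMatrix i v w = X.adjacencyMatrix i w v := by
  have h : Function.Involutive (X.reverse (i := i)) := X.reverse_reverse
  refine Nat.card_congr (h.toPerm.subtypeEquiv fun e => ?_)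
  change _ ↔ X.terminus e = w ∧ X.corner (X.reverse (X.reverse e)) = v
  rw [X.reverse_reverse]
  exact and_comm

/-- The edges of direction `i` of a product of graphs that start at `z` correspond to the
neighbours of the `i`-th coordinate of `z`. -/
noncomputable def prodGraphEdgeEquiv {V : Fin k → Type u} (T : ∀ i, SimpleGraph (V i)) (i : Fin k)
    (z : (prodGraph T).Vertex) :
    {b : (prodGraph T).OrientedEdge i // (prodGraph T).origin b = z} ≃
      (T i).neighborSet (z.1.1 i) :=
  Equiv.ofBijective (fun b => ⟨b.1.1.2 i, by
      have h := ((b.1.2 i).1 (by simp))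
      rwa [← prodGraph_corner_fst, show (prodGraph T).corner b.1 = z from b.2] at h⟩) <| by
    constructor
    · rintro ⟨b, hb⟩ ⟨b', hb'⟩ h
      refine Subtype.ext (prodGraph_ext _ _ (hb.trans hb'.symm) fun j hj => ?_)
      obtain rfl := Finset.mem_singleton.mp hj
      exact Subtype.ext_iff.mp h
    · rintro ⟨y, hy⟩
      refine ⟨⟨⟨(z.1.1, Function.update z.1.1 i y), fun j => ⟨fun hj => ?_, fun hj => ?_⟩⟩,
        prodGraph_vertex_ext _ _ rfl⟩, Subtype.ext (Function.update_self i y _)⟩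
      · obtain rfl := Finset.mem_singleton.mp hj
        simpa using hy
      · exact Function.update_of_ne (fun h => hj (Finset.mem_singleton.mpr h)) _ _

/-- The covering is a bijection on stars, so the count may be made at a lift `z` of `v`. -/
theorem IsCoveredByTrees.card_edges {X : CubeComplex.{u} k} {n : Fin k → ℕ}
    (hX : X.IsCoveredByTrees n) (i : Fin k) (v : X.Vertex) :
    Nat.card {e : X.OrientedEdge i // X.origin e = v} = n i := by
  obtain ⟨V, T, hT, p, hs, hp⟩ := hX
  obtain ⟨z, rfl⟩ := hs v
  have h1 : Nat.card ((T i).neighborSet (z.1.1 i)) = n i := by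
    change Set.ncard _ = _
    rw [Set.ncard, (hT i).2, ENat.toNat_natCast]
  rw [← h1, ← Nat.card_congr (prodGraphEdgeEquiv T i z)]
  symm
  refine Nat.card_congr (Equiv.ofBijective (fun b => ⟨p.toFun b.1, ?_⟩) ⟨?_, ?_⟩)
  · exact (p.map_corner b.1).symm.trans (congrArg p.toFun b.2)
  · rintro ⟨b, hb⟩ ⟨b', hb'⟩ h
    exact Subtype.ext ((hp {i} z (p.toFun b)
      ((p.map_corner b).symm.trans (congrArg p.toFun hb))).unique ⟨hb, rfl⟩
      ⟨hb', (Subtype.ext_iff.mp h).symm⟩)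
  · rintro ⟨e, he⟩
    obtain ⟨b, ⟨hb, hb'⟩, -⟩ := hp {i} z e he
    exact ⟨⟨b, hb⟩, Subtype.ext hb'⟩

/-- The row sum sorts the edges starting at `v` by their terminus. -/
theorem IsCoveredByTrees.sum_adjacencyMatrix {X : CubeComplex.{u} k} {n : Fin k → ℕ}
    (hX : X.IsCoveredByTrees n) [Fintype X.Vertex] (i : Fin k) (v : X.Vertex) :
    ∑ w, X.adjacencyMatrix i v w = n i := by
  have := hX.finite_edges i
  rw [← hX.card_edges i v]
  unfold adjacencyMatrix
  rw [← Nat.card_sigma]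
  exact Nat.card_congr
    { toFun := fun a => ⟨a.2.1, a.2.2.1⟩
      invFun := fun e => ⟨X.terminus e.1, e.1, e.2, rfl⟩
      left_inv := by
        rintro ⟨w, e, he, rfl⟩
        rfl
      right_inv := fun _ => rfl }

/-- The `(v, w)` entry on the left counts edges from the source `w` to the range `v`, so the
identification passes through the symmetry of the adjacency matrix. -/
theorem coordinateMatrix_kGraph (X : CubeComplex.{u} k) {n : Fin k → ℕ}
    (hX : X.IsCoveredByTrees n) [Finite X.Vertex] (i : Fin k) :
    (X.kGraph hX).coordinateMatrix i = X.adjacencyMatrix i := by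
  funext v w
  refine ((X.digraph hX).coordinateMatrix_apply i v w).trans
    (.trans (Nat.card_congr ?_) (X.adjacencyMatrix_symm i w v))
  exact
    { toFun := fun e => ⟨e.2.1 ▸ e.1.2, by
        obtain ⟨⟨j, e⟩, rfl, h⟩ := e
        exact h⟩
      invFun := fun e => ⟨⟨i, e.1⟩, rfl, e.2⟩
      left_inv := by
        rintro ⟨⟨j, e⟩, rfl, h⟩
        rfl
      right_inv := fun _ => rfl }

end CubeComplex

theorem proposition5p1 {k : ℕ} (hk : 2 ≤ k) (n : Fin k → ℕ) (hn : ∀ i, 0 < n i)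
    (N : ℕ) (hN : 1 ≤ N) (X : CubeComplex.{u} k) (hX : X.IsCoveredByTrees n)
    [Finite X.Vertex] (hXN : Nat.card X.Vertex = N) :
    (X.kGraph hX).IsKGraph ∧
      (∀ i, (X.kGraph hX).coordinateMatrix i = X.adjacencyMatrix i ∧
        ((X.kGraph hX).coordinateMatrix i).IsSymm ∧
        ∀ v, ∑ w, (X.kGraph hX).coordinateMatrix i v w = n i) ∧
      (X.kGraph hX).spectralRadiusVector = fun i => (n i : ℝ≥0∞) := by
  have hsum : ∀ i v, ∑ w, (X.kGraph hX).coordinateMatrix i v w = n i := by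
    intro i v
    rw [X.coordinateMatrix_kGraph hX]
    -- The sum runs over the objects of the category, so their `Fintype` instance is supplied for
    -- the vertices.
    exact @CubeComplex.IsCoveredByTrees.sum_adjacencyMatrix _ X n hX
      (CubeComplex.instFintypeObjKGraph X hX) i v
  refine ⟨(X.digraph hX).isKGraph, fun i => ⟨X.coordinateMatrix_kGraph hX i, ?_, hsum i⟩, ?_⟩
  · rw [X.coordinateMatrix_kGraph hX]
    exact Matrix.IsSymm.ext fun v w => X.adjacencyMatrix_symm i w v
  · have : Nonempty X.Vertex := (Nat.card_pos_iff.mp (hXN ▸ hN)).1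
    have : Nonempty (X.kGraph hX).Obj := this
    funext i
    classical exact spectralRadius_map_natCast_of_row_sum _ _ (hsum i)
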